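/- **Setting.** Let $\ell(\hat y,y)=\log(1+e^{-y\hat y})$ be the logistic loss, and for a probability law $Q$ on $\mathbb R^m\times\{-1,1\}$ let $L(w,Q)=\mathbb E_{(x,y)\sim Q}\,\ell(w^\top x,y)$. The $d$ features are partitioned into $K$ nonempty groups; group $k$ has $d_k$ features, importance $q_k\ge 0$ (with $\sum_k q_k=1$), regularization parameter $\lambda_k>0$ and regularizer $g_k(w)=\tfrac12\|w-u_k\|^2$, where $u_k\in\mathbb R^{d_k}$ is any constant vector. Let $\epsilon>0$ be the privacy budget. Samples $(x_i,y_i)$, $i=1,\dots,n$, are drawn i.i.d. from a law $P$ on $\mathbb R^d\times\{-1,1\}$; for each $k$ the vector $x_{i,(k)}$ of features in group $k$ is scaled (by a factor that is a fixed measurable function of $x_{i,(k)}$) to a vector $x_i^{(k)}$ with $\|x_i^{(k)}\|\le q_k$ almost surely. Let $P_k$ be the law of $(x_i^{(k)},y_i)$. The low-level stage of PST-F (privacy-preserving stacking with feature partitioning) is as follows. Put $$\epsilon'=\epsilon-\sum_{k=1}^K\log\Bigl(1+\frac{q_k^2}{2n\lambda_k}+\frac{q_k^4}{16n^2\lambda_k^2}\Bigr).$$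 If $\epsilon'>0$, put $\Delta_k=0$ and $\epsilon_k=\epsilon'$; otherwise put $\Delta_k=\frac{q_k^2}{4n(\exp(\epsilon q_k/4)-1)}-\lambda_k$ and $\epsilon_k=\epsilon/2$. Draw independent noise vectors $b_k\in\mathbb R^{d_k}$, independent of the samples, with density proportional to $\exp(-\epsilon_k\|b\|/2)$, and let $$w_k^l\in\arg\min_{w\in\mathbb R^{d_k}}\ \frac1n\sum_{i=1}^n\ell(w^\top x_i^{(k)},y_i)+\frac{b_k^\top w}{n}+\frac{\Delta_k\|w\|^2}{2}+\lambda_k g_k(w).$$ **Theorem.** For every $K$, every $R>0$ and every $\delta_0<1$ there is a constant $C_1>0$, depending only on $K,R,\delta_0$, such that the following holds for all $d$, $P$ and all inputs as above. Let $0<\delta\le\delta_0$ and $\epsilon_g>0$, let $v_k\in\mathbb R^{d_k}\setminus\{0\}$ be reference parameters, let $a_k=q_k\|v_k\|$, and let the regularization parameters satisfy $$\frac{\epsilon_g}{R\,\|v_k\|^2}\le\lambda_k\quad\text{and}\quad \lambda_k\|v_k-u_k\|^2\le\epsilon_g\qquad(k=1,\dots,K)$$ (for given $u_k$ and $v_k\neq0$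 such $\lambda_k$ exist as soon as $R\ge\|v_k-u_k\|^2/\|v_k\|^2$; if $u_k=0$ and $R\ge 1$, one may take $\lambda_k=\epsilon_g/\|v_k\|^2$). If $$n> C_1\max\Bigl(\frac{a_k^2\log(1/\delta)}{\epsilon_g^2},\ \frac{d\log\bigl(d/(K\delta)\bigr)\,a_k}{q_kK\epsilon_g\epsilon},\ \frac{a_k^2}{\epsilon_g\epsilon}\Bigr)\qquad\text{for } k=1,\dots,K$$ (the second term being read as $0$ if $q_k=0$), then for each $k$ the minimizer $w_k^l$ exists and $$\Pr\bigl[L(w_k^l,P_k)\le L(v_k,P_k)+\epsilon_g\bigr]\ge 1-\delta .$$ -/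

import Mathlib

open MeasureTheory

noncomputable section

/-- The logistic loss `ℓ(ŷ, y) = log (1 + exp (-y ŷ))`. -/
def logisticLoss (yhat y : ℝ) : ℝ :=
  Real.log (1 + Real.exp (-y * yhat))

/-- The expected loss `L(w, Q) = 𝔼_{(x, y) ∼ Q} ℓ(wᵀx, y)` of the linear model `w`. -/
def expectedLoss {ι : Type} [Fintype ι] (w : EuclideanSpace ℝ ι)
    (Q : Measure (EuclideanSpace ℝ ι × ℝ)) : ℝ :=
  ∫ z, logisticLoss (inner ℝ w z.1) z.2 ∂Q

/-- The probability law on `ℝ^ι` whose density is proportional to `exp (-(β / 2) ‖b‖)`. -/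
def noiseLaw (ι : Type) [Fintype ι] (β : ℝ) : Measure (EuclideanSpace ℝ ι) :=
  let ρ : Measure (EuclideanSpace ℝ ι) :=
    volume.withDensity fun b => ENNReal.ofReal (Real.exp (-(β / 2 * ‖b‖)))
  (ρ Set.univ)⁻¹ • ρ

/-- The input (other than the data) of privacy-preserving stacking with feature partitioning:
`d` features that are partitioned into `K` nonempty groups, and one low-level model per group. -/
structure PSTF (d K : ℕ) where
  /-- the group of each feature -/
  group : Fin d → Fin K
  group_surjective : Function.Surjective group
  /-- the privacy budget -/
  eps : ℝ
  eps_pos : 0 < eps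
  /-- the importance of each feature group -/
  q : Fin K → ℝ
  q_nonneg : ∀ k, 0 ≤ q k
  q_sum : ∑ k, q k = 1
  /-- the regularization parameter of each low-level model -/
  lam : Fin K → ℝ
  lam_pos : ∀ k, 0 < lam k
  /-- the regularizer of each low-level model -/
  g : ∀ k, EuclideanSpace ℝ {i : Fin d // group i = k} → ℝ
  /-- the factor by which the features of a sample in group `k` are scaled -/
  scale : ∀ k, EuclideanSpace ℝ {i : Fin d // group i = k} → ℝ
  measurable_scale : ∀ k, Measurable (scale k)

namespace PSTF

variable {d K : ℕ} (A : PSTF d K)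

/-- The parameter space (equivalently, the feature space) of the `k`-th low-level model. -/
abbrev Model (k : Fin K) : Type := EuclideanSpace ℝ {i : Fin d // A.group i = k}

/-- The part of `x` made of the features in group `k`. -/
def restrict (k : Fin K) (x : EuclideanSpace ℝ (Fin d)) : A.Model k :=
  WithLp.toLp 2 fun i => x i.1

/-- The scaled sample of group `k` obtained from the sample `(x, y)`. -/
def groupSample (k : Fin K) (z : EuclideanSpace ℝ (Fin d) × ℝ) : A.Model k × ℝ :=
  (A.scale k (A.restrict k z.1) • A.restrict k z.1, z.2)

/-- The distribution of the scaled samples of group `k`, for samples drawn from `P`. -/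
def groupLaw (k : Fin K) (P : Measure (EuclideanSpace ℝ (Fin d) × ℝ)) :
    Measure (A.Model k × ℝ) :=
  P.map (A.groupSample k)

/-- `ε' = ε - ∑ₖ log (1 + qₖ² / (2 n λₖ) + qₖ⁴ / (16 n² λₖ²))`. -/
def epsPrime (n : ℕ) : ℝ :=
  A.eps - ∑ k, Real.log (1 + A.q k ^ 2 / (2 * n * A.lam k)
    + A.q k ^ 4 / (16 * (n : ℝ) ^ 2 * A.lam k ^ 2))

open Classical in
/-- The extra regularization `Δₖ`. -/
def Delta (n : ℕ) (k : Fin K) : ℝ :=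
  if 0 < A.epsPrime n then 0
  else A.q k ^ 2 / (4 * n * (Real.exp (A.eps * A.q k / 4) - 1)) - A.lam k

open Classical in
/-- The noise parameter `εₖ` (the same for all `k`). -/
def epsNoise (n : ℕ) : ℝ :=
  if 0 < A.epsPrime n then A.epsPrime n else A.eps / 2

/-- The perturbed objective of the `k`-th low-level model, for the samples `z` and the noise
vector `b`. -/
def objective (n : ℕ) (k : Fin K) (z : Fin n → EuclideanSpace ℝ (Fin d) × ℝ) (b w : A.Model k) :
    ℝ :=
  1 / n * ∑ i, logisticLoss (inner ℝ w (A.groupSample k (z i)).1) (A.groupSample k (z i)).2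
    + inner ℝ b w / n + A.Delta n k * ‖w‖ ^ 2 / 2 + A.lam k * A.g k w

/-- The outcomes of the random experiment: the `n` samples used to train the low-level models
and the noise vectors `b₁, …, b_K`. -/
abbrev Outcome (n : ℕ) : Type :=
  (Fin n → EuclideanSpace ℝ (Fin d) × ℝ) × (∀ k, A.Model k)

/-- The law of the outcome: i.i.d. samples from `P`, and independent noise vectors that are also
independent of the samples. -/
def outcomeLaw (n : ℕ) (P : Measure (EuclideanSpace ℝ (Fin d) × ℝ)) : Measure (A.Outcome n) :=
  (Measure.pi fun _ : Fin n => P).prod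
    (Measure.pi fun k : Fin K => noiseLaw {i : Fin d // A.group i = k} (A.epsNoise n))

/-- The `k`-th low-level model: a minimizer of the perturbed objective (any vector, if there is
none). -/
def lowModel (n : ℕ) (k : Fin K) (ω : A.Outcome n) : A.Model k :=
  Classical.epsilon fun w => IsMinOn (A.objective n k ω.1 (ω.2 k)) Set.univ w

end PSTF

end

noncomputable section

open scoped ENNReal

/-! The minimizer is localized around `w₀`, the minimizer of the regularized population objective,
in a ball of radius `‖v k‖`. On its boundary quadratic growth costs `λ‖v‖²/4 ≥ εg/(4R)`. If the
centred empirical losses deviate by at most `c εg / 2` on the ball, and the noise term `b/n` has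
norm at most `c εg / (2‖v‖)`, then both errors together are at most `c εg`, less than this cost.
Convexity keeps the perturbed minimizer inside the ball, where its excess objective is at most `c εg
≤ εg/2` (`objective_sub_le_of_isMinOn`). Comparison with `v`, whose regularizer costs at most
`εg/2`, gives the claim.

The deviation bound must not involve the dimension. An exponential moment of the supremum is bounded
one sample at a time: symmetrization and contraction replace each loss by a signed linear
functional, and a `cosh` inequality in inner product spaces controls the resulting vector sum
(`lintegral_pi_iSup_eexp_le`). The dimension enters only through the noise tail
(`noiseLaw_lt_norm_le`). The remaining condition on `n` forces `ε' ≥ ε/2` (`half_eps_le_epsPrime`),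
so `Δ` vanishes and the noise scale is under control. -/

/-- The exponential of a real number, as an extended nonnegative real. -/
def eexp (x : ℝ) : ℝ≥0∞ := ENNReal.ofReal (Real.exp x)

theorem measurable_eexp : Measurable eexp :=
  ENNReal.measurable_ofReal.comp Real.measurable_exp

theorem eexp_mono {x y : ℝ} (h : x ≤ y) : eexp x ≤ eexp y :=
  ENNReal.ofReal_le_ofReal (Real.exp_le_exp.2 h)

/-! ### Two-point contraction and the `cosh` inequality. -/

/-- Convexity of `exp`: its increment over an interval grows with the left endpoint and with the
length. -/
theorem exp_add_exp_le_of_sub_le {a b a' b' : ℝ} (h : a' ≤ a) (h' : a' ≤ b')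
    (hd : b' - a' ≤ b - a) : Real.exp a + Real.exp b' ≤ Real.exp b + Real.exp a' := by
  have e1 : Real.exp b' = Real.exp a' * Real.exp (b' - a') := by
    rw [← Real.exp_add]; ring_nf
  have e2 : Real.exp b = Real.exp a * Real.exp (b - a) := by
    rw [← Real.exp_add]; ring_nf
  have h1 := Real.exp_le_exp.2 h
  have h2 := Real.exp_le_exp.2 hd
  have h3 : 1 ≤ Real.exp (b' - a') := Real.one_le_exp (by linarith)
  have h4 := Real.exp_pos a'
  rw [e1, e2]
  nlinarith [Real.exp_pos a]

theorem exists_exp_add_exp_le_of_nonneg {ι : Type*} (H f L : ι → ℝ) (i j : ι)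
    (hi : |f i| ≤ L i) (hj : |f j| ≤ L j) (hij : |f i - f j| ≤ |L i - L j|) :
    ∃ i' j', Real.exp (H i + f i) + Real.exp (H j - f j)
      ≤ Real.exp (H i' + L i') + Real.exp (H j' - L j') := by
  have hi1 := abs_le.1 hi
  have hj1 := abs_le.1 hj
  rcases le_total (L j) (L i) with h | h
  · rw [abs_of_nonneg (sub_nonneg.2 h)] at hij
    have hij1 := abs_le.1 hij
    rcases le_total (H j + f j) (H i + f i) with h' | h'
    · exact ⟨i, j, exp_add_exp_le_of_sub_le (by linarith) (by linarith) (by linarith)⟩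
    -- Index `j` is at least as good as `i` in the first term. Using it in both leaves the symmetric
    -- comparison of `H j ± f j` with `H j ± L j`.
    · refine ⟨j, j, le_trans (add_le_add_left (Real.exp_le_exp.2 h') _) ?_⟩
      exact exp_add_exp_le_of_sub_le (by linarith) (by linarith) (by linarith)
  · rw [abs_sub_comm (L i), abs_of_nonneg (sub_nonneg.2 h)] at hij
    have hij1 := abs_le.1 hij
    rcases le_total (H i - f i) (H j - f j) with h' | h'
    · refine ⟨j, i, ?_⟩
      rw [add_comm]
      exact exp_add_exp_le_of_sub_le (by linarith) (by linarith) (by linarith)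
    · refine ⟨i, i, le_trans (add_le_add_right (Real.exp_le_exp.2 h') _) ?_⟩
      exact exp_add_exp_le_of_sub_le (by linarith) (by linarith) (by linarith)

/-- The two-point form of the contraction principle for Rademacher averages. -/
theorem exists_exp_add_exp_le {ι : Type*} (H f L : ι → ℝ) (i j : ι)
    (hi : |f i| ≤ |L i|) (hj : |f j| ≤ |L j|) (hij : |f i - f j| ≤ |L i - L j|) :
    ∃ i' j', Real.exp (H i + f i) + Real.exp (H j - f j)
      ≤ Real.exp (H i' + L i') + Real.exp (H j' - L j') := by
  -- For opposite signs of `L` the bound holds term by term, after a swap of indices if `L i ≤ 0`.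
  -- Two nonpositive values reduce to `-L`, which also swaps the indices.
  rcases le_total 0 (L i) with h1 | h1 <;> rcases le_total 0 (L j) with h2 | h2
  · rw [abs_of_nonneg h1] at hi
    rw [abs_of_nonneg h2] at hj
    exact exists_exp_add_exp_le_of_nonneg H f L i j hi hj hij
  · rw [abs_of_nonneg h1] at hi
    rw [abs_of_nonpos h2] at hj
    refine ⟨i, j, add_le_add (Real.exp_le_exp.2 ?_) (Real.exp_le_exp.2 ?_)⟩
    · linarith [(abs_le.1 hi).2]
    · linarith [(abs_le.1 hj).1]
  · rw [abs_of_nonpos h1] at hi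
    rw [abs_of_nonneg h2] at hj
    refine ⟨j, i, ?_⟩
    rw [add_comm]
    refine add_le_add (Real.exp_le_exp.2 ?_) (Real.exp_le_exp.2 ?_)
    · linarith [(abs_le.1 hj).1]
    · linarith [(abs_le.1 hi).2]
  · rw [abs_of_nonpos h1] at hi
    rw [abs_of_nonpos h2] at hj
    obtain ⟨i', j', h⟩ := exists_exp_add_exp_le_of_nonneg H f (fun t => - L t) i j hi hj
      (by rw [abs_sub_comm (L i)] at hij; convert hij using 2; ring)
    refine ⟨j', i', h.trans_eq ?_⟩
    rw [add_comm, sub_neg_eq_add, sub_eq_add_neg]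

theorem iSup_eexp_contraction {ι : Type*} [Nonempty ι] (H f L : ι → ℝ)
    (hf : ∀ i, |f i| ≤ |L i|) (hij : ∀ i j, |f i - f j| ≤ |L i - L j|) :
    (⨆ t, eexp (H t + f t)) + ⨆ t, eexp (H t - f t)
      ≤ (⨆ t, eexp (H t + L t)) + ⨆ t, eexp (H t - L t) := by
  refine ENNReal.iSup_add_iSup_le fun i j => ?_
  obtain ⟨i', j', h⟩ := exists_exp_add_exp_le H f L i j (hf i) (hf j) (hij i j)
  refine le_trans ?_ (add_le_add (le_iSup (fun t => eexp (H t + L t)) i')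
    (le_iSup (fun t => eexp (H t - L t)) j'))
  simp only [eexp]
  rw [← ENNReal.ofReal_add (Real.exp_nonneg _) (Real.exp_nonneg _),
    ← ENNReal.ofReal_add (Real.exp_nonneg _) (Real.exp_nonneg _)]
  exact ENNReal.ofReal_le_ofReal h

/-- The points `a ± c` are convex combinations of `a ± C` with exchanged weights, and powers are
convex on the nonnegative half-line. -/
theorem add_pow_add_sub_pow_le {a c C : ℝ} (hc : |c| ≤ C) (hC : C ≤ a) (n : ℕ) :
    (a + c) ^ n + (a - c) ^ n ≤ (a + C) ^ n + (a - C) ^ n := by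
  have hc1 := abs_le.1 hc
  have hC0 : 0 ≤ C := (abs_nonneg c).trans hc
  rcases hC0.eq_or_lt with h | h
  · have : c = 0 := by
      rw [← h] at hc
      exact abs_nonpos_iff.1 hc
    rw [this, ← h]
  · have hp := (convexOn_pow (𝕜 := ℝ) n).2
    have hm : a - C ∈ Set.Ici (0 : ℝ) := by simp; linarith
    have hM : a + C ∈ Set.Ici (0 : ℝ) := by simp; linarith
    have hs : (C + c) / (2 * C) + (C - c) / (2 * C) = 1 := by field_simp; ring
    have p1 : 0 ≤ (C + c) / (2 * C) := div_nonneg (by linarith) (by linarith)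
    have p2 : 0 ≤ (C - c) / (2 * C) := div_nonneg (by linarith) (by linarith)
    have h1 := hp hM hm p1 p2 hs
    have h2 := hp hm hM p1 p2 hs
    simp only [smul_eq_mul] at h1 h2
    have e1 : (C + c) / (2 * C) * (a + C) + (C - c) / (2 * C) * (a - C) = a + c := by
      field_simp; ring
    have e2 : (C + c) / (2 * C) * (a - C) + (C - c) / (2 * C) * (a + C) = a - c := by
      field_simp; ring
    rw [e1] at h1
    rw [e2] at h2
    calc _ ≤ _ := add_le_add h1 h2
      _ = ((C + c) / (2 * C) + (C - c) / (2 * C)) * ((a + C) ^ n + (a - C) ^ n) := by ring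
      _ = _ := by rw [hs, one_mul]

/-- The collinear case is the extreme one. Since `cosh ‖x‖` is a power series in `‖x‖²` with
nonnegative coefficients, Cauchy–Schwarz and `add_pow_add_sub_pow_le` compare the two sides
coefficient by coefficient. -/
theorem cosh_norm_add_add_cosh_norm_sub_le {E : Type*} [NormedAddCommGroup E]
    [InnerProductSpace ℝ E] (x y : E) :
    Real.cosh ‖x + y‖ + Real.cosh ‖x - y‖ ≤ 2 * (Real.cosh ‖x‖ * Real.cosh ‖y‖) := by
  have e : 2 * (Real.cosh ‖x‖ * Real.cosh ‖y‖)
      = Real.cosh (‖x‖ + ‖y‖) + Real.cosh (‖x‖ - ‖y‖) := by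
    rw [Real.cosh_add, Real.cosh_sub]; ring
  rw [e]
  refine hasSum_le (fun n => ?_) ((Real.hasSum_cosh ‖x + y‖).add (Real.hasSum_cosh ‖x - y‖))
    ((Real.hasSum_cosh (‖x‖ + ‖y‖)).add (Real.hasSum_cosh (‖x‖ - ‖y‖)))
  rw [← add_div, ← add_div]
  refine div_le_div_of_nonneg_right ?_ (Nat.cast_nonneg _)
  have h1 : ‖x + y‖ ^ 2 = (‖x‖ ^ 2 + ‖y‖ ^ 2) + 2 * inner ℝ x y := by
    rw [norm_add_sq_real]; ring
  have h2 : ‖x - y‖ ^ 2 = (‖x‖ ^ 2 + ‖y‖ ^ 2) - 2 * inner ℝ x y := by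
    rw [norm_sub_sq_real]; ring
  have h3 : (‖x‖ + ‖y‖) ^ 2 = (‖x‖ ^ 2 + ‖y‖ ^ 2) + 2 * (‖x‖ * ‖y‖) := by ring
  have h4 : (‖x‖ - ‖y‖) ^ 2 = (‖x‖ ^ 2 + ‖y‖ ^ 2) - 2 * (‖x‖ * ‖y‖) := by ring
  rw [pow_mul, pow_mul, pow_mul, pow_mul, h1, h2, h3, h4]
  refine add_pow_add_sub_pow_le ?_ ?_ n
  · rw [abs_mul, abs_two]
    gcongr
    exact abs_real_inner_le_norm x y
  · nlinarith [sq_nonneg (‖x‖ - ‖y‖)]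

theorem eexp_add_le (x y : ℝ) : eexp (x + y) ≤ 2⁻¹ * (eexp (2 * x) + eexp (2 * y)) := by
  have h : Real.exp (x + y) ≤ 2⁻¹ * (Real.exp (2 * x) + Real.exp (2 * y)) := by
    rw [Real.exp_add, two_mul, two_mul, Real.exp_add, Real.exp_add]
    nlinarith [sq_nonneg (Real.exp x - Real.exp y)]
  simp only [eexp]
  rw [← ENNReal.ofReal_add (Real.exp_nonneg _) (Real.exp_nonneg _)]
  refine (ENNReal.ofReal_le_ofReal h).trans_eq ?_
  rw [ENNReal.ofReal_mul (by norm_num), ENNReal.ofReal_inv_of_pos (by norm_num)]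
  simp

/-! ### A dimension-free uniform deviation bound. -/

section Concentration

variable {Ω : Type*} [MeasurableSpace Ω] {P : Measure Ω} [IsProbabilityMeasure P]

theorem eexp_integral_le {f : Ω → ℝ} {B : ℝ} (hf : Measurable f) (hB : ∀ᵐ z ∂P, |f z| ≤ B) :
    eexp (∫ z, f z ∂P) ≤ ∫⁻ z, eexp (f z) ∂P := by
  have hi : Integrable f P :=
    Integrable.of_bound hf.aestronglyMeasurable B (by simpa [Real.norm_eq_abs] using hB)
  have he : Integrable (fun z => Real.exp (f z)) P :=
    Integrable.of_bound hf.exp.aestronglyMeasurable (Real.exp B) (by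
      filter_upwards [hB] with z hz
      rw [Real.norm_eq_abs, Real.abs_exp]
      exact Real.exp_le_exp.2 ((le_abs_self _).trans hz))
  have h := convexOn_exp.map_integral_le Real.continuous_exp.continuousOn isClosed_univ
    (by simp) hi he
  simp only [eexp]
  rw [← ofReal_integral_eq_lintegral_ofReal he (by filter_upwards with z using Real.exp_nonneg _)]
  exact ENNReal.ofReal_le_ofReal h

/-- Symmetrization without a ghost sample. The inequality `eexp_add_le` separates the mean from the
sample value, half of `H` going to each; Jensen turns the mean into a second average over `z`. The
two suprema then carry opposite signs, as the pointwise contraction requires. -/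
theorem lintegral_iSup_eexp_le {ι : Type*} [Nonempty ι] [Countable ι] {H : ι → ℝ}
    {f L : ι → Ω → ℝ} {B : ℝ} (hf : ∀ t, Measurable (f t))
    (hB : ∀ᵐ z ∂P, ∀ t, |f t z| ≤ B)
    (hfL : ∀ᵐ z ∂P, ∀ t, |f t z| ≤ |L t z|)
    (hfL' : ∀ᵐ z ∂P, ∀ s t, |f s z - f t z| ≤ |L s z - L t z|) :
    ∫⁻ z, ⨆ t, eexp (H t + (∫ z', f t z' ∂P - f t z)) ∂P
      ≤ ∫⁻ z, 2⁻¹ * ((⨆ t, eexp (H t + 2 * L t z)) + ⨆ t, eexp (H t - 2 * L t z)) ∂P := by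
  have m1 : Measurable fun z => ⨆ t, eexp (H t + 2 * f t z) :=
    Measurable.iSup fun t => measurable_eexp.comp (((hf t).const_mul 2).const_add _)
  have m2 : Measurable fun z => ⨆ t, eexp (H t - 2 * f t z) :=
    Measurable.iSup fun t => measurable_eexp.comp (((hf t).const_mul 2).const_sub _)
  have jensen : (⨆ t, eexp (H t + 2 * ∫ z, f t z ∂P)) ≤ ∫⁻ z, ⨆ t, eexp (H t + 2 * f t z) ∂P := by
    refine iSup_le fun t => ?_
    have hi : Integrable (f t) P :=
      Integrable.of_bound (hf t).aestronglyMeasurable B (by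
        filter_upwards [hB] with z hz using hz t)
    have e : H t + 2 * ∫ z, f t z ∂P = ∫ z, H t + 2 * f t z ∂P := by
      rw [integral_add (integrable_const _) (hi.const_mul 2), integral_const_mul]; simp
    rw [e]
    refine (eexp_integral_le (B := |H t| + 2 * B) (((hf t).const_mul 2).const_add _) ?_).trans ?_
    · filter_upwards [hB] with z hz
      refine (abs_add_le _ _).trans ?_
      rw [abs_mul, abs_two]
      linarith [hz t]
    · exact lintegral_mono fun z => le_iSup (fun t => eexp (H t + 2 * f t z)) t
  calc ∫⁻ z, ⨆ t, eexp (H t + (∫ z', f t z' ∂P - f t z)) ∂P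
      ≤ ∫⁻ z, 2⁻¹ * ((⨆ t, eexp (H t + 2 * ∫ z, f t z ∂P)) + ⨆ t, eexp (H t - 2 * f t z)) ∂P := by
        refine lintegral_mono fun z => iSup_le fun t => ?_
        have e : H t + (∫ z', f t z' ∂P - f t z)
          = (H t / 2 + ∫ z', f t z' ∂P) + (H t / 2 - f t z) := by ring
        rw [e]
        refine (eexp_add_le _ _).trans ?_
        gcongr
        · refine le_trans (le_of_eq ?_) (le_iSup (fun t => eexp (H t + 2 * ∫ z, f t z ∂P)) t)
          congr 1; ring
        · refine le_trans (le_of_eq ?_) (le_iSup (fun t => eexp (H t - 2 * f t z)) t)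
          congr 1; ring
    _ ≤ ∫⁻ z, 2⁻¹ * ((⨆ t, eexp (H t + 2 * f t z)) + ⨆ t, eexp (H t - 2 * f t z)) ∂P := by
        rw [lintegral_const_mul _ (m2.const_add _), lintegral_const_mul _ (m1.fun_add m2),
          lintegral_add_left measurable_const, lintegral_add_left m1, lintegral_const]
        simp only [measure_univ, mul_one]
        gcongr
    _ ≤ _ := by
        refine lintegral_mono_ae ?_
        filter_upwards [hfL, hfL'] with z h1 h2
        gcongr 2⁻¹ * ?_
        refine iSup_eexp_contraction H (fun t => 2 * f t z) (fun t => 2 * L t z) ?_ ?_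
        · intro t
          simp only [abs_mul]
          exact mul_le_mul_of_nonneg_left (h1 t) (abs_nonneg _)
        · intro s t
          simp only [← mul_sub, abs_mul]
          exact mul_le_mul_of_nonneg_left (h2 s t) (abs_nonneg _)

variable {E : Type*} [NormedAddCommGroup E] [InnerProductSpace ℝ E] [FiniteDimensional ℝ E]
  [MeasurableSpace E] [BorelSpace E]

/-- The vector `S` makes the induction close: linearizing one sample replaces `S` by `S ± 2 X z`,
and averaging over the sign costs one factor `cosh (2 r q)`. -/
theorem lintegral_pi_iSup_eexp_le {ι : Type*} [Nonempty ι] [Countable ι] {f : ι → Ω → ℝ}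
    {v : ι → E} {X : Ω → E} {r q : ℝ} (hr : 0 ≤ r)
    (hf : ∀ t, Measurable (f t)) (hX : Measurable X)
    (hv : ∀ t, ‖v t‖ ≤ r) (hXq : ∀ᵐ z ∂P, ‖X z‖ ≤ q)
    (hfL : ∀ᵐ z ∂P, ∀ t, |f t z| ≤ |inner ℝ (v t) (X z)|)
    (hfL' : ∀ᵐ z ∂P, ∀ s t, |f s z - f t z| ≤ |inner ℝ (v s) (X z) - inner ℝ (v t) (X z)|)
    (n : ℕ) (S : E) :
    ∫⁻ z : Fin n → Ω, ⨆ t, eexp (inner ℝ (v t) S + ∑ i, (∫ z', f t z' ∂P - f t (z i)))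
        ∂(Measure.pi fun _ => P)
      ≤ ENNReal.ofReal (2 * Real.cosh (r * ‖S‖) * Real.cosh (2 * r * q) ^ n) := by
  have hLm : ∀ t, Measurable fun z => inner ℝ (v t) (X z) := fun t => hX.const_inner
  have hB : ∀ᵐ z ∂P, ∀ t, |f t z| ≤ r * q := by
    filter_upwards [hfL, hXq] with z h1 h2 t
    refine (h1 t).trans ((abs_real_inner_le_norm _ _).trans ?_)
    exact mul_le_mul (hv t) h2 (norm_nonneg _) hr
  induction n generalizing S with
  | zero =>
    simp only [Finset.univ_eq_empty, Finset.sum_empty, add_zero, pow_zero, mul_one,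
      lintegral_const, measure_univ]
    refine iSup_le fun t => ENNReal.ofReal_le_ofReal ?_
    calc Real.exp (inner ℝ (v t) S) ≤ Real.exp (r * ‖S‖) := by
          refine Real.exp_le_exp.2 ((real_inner_le_norm _ _).trans ?_)
          gcongr
          exact hv t
      _ ≤ _ := by
          rw [Real.cosh_eq]
          linarith [Real.exp_pos (-(r * ‖S‖))]
  | succ n ih =>
    have hm : ∀ t, Measurable fun z : Fin n → Ω => ∑ i, (∫ z', f t z' ∂P - f t (z i)) :=
      fun t => Finset.measurable_fun_sum _ fun i _ =>
        ((hf t).comp (measurable_pi_apply i)).const_sub _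
    have hG : Measurable fun p : Ω × (Fin n → Ω) => ⨆ t, eexp (inner ℝ (v t) S +
        ∑ i, (∫ z', f t z' ∂P - f t (p.2 i)) + (∫ z', f t z' ∂P - f t p.1)) :=
      Measurable.iSup fun t => measurable_eexp.comp
        ((((hm t).comp measurable_snd).const_add _).add
          (((hf t).comp measurable_fst).const_sub _))
    have hsplit := (measurePreserving_piFinSuccAbove (fun _ : Fin (n + 1) => P) 0).lintegral_comp hG
    have e : ∀ z : Fin (n + 1) → Ω,
        (⨆ t, eexp (inner ℝ (v t) S + ∑ i, (∫ z', f t z' ∂P - f t (z i))))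
        = ⨆ t, eexp (inner ℝ (v t) S + ∑ i, (∫ z', f t z' ∂P -
          f t ((MeasurableEquiv.piFinSuccAbove (fun _ => Ω) 0 z).2 i))
          + (∫ z', f t z' ∂P - f t (MeasurableEquiv.piFinSuccAbove (fun _ => Ω) 0 z).1)) := by
      intro z
      refine iSup_congr fun t => ?_
      rw [Fin.sum_univ_succ, add_assoc, add_comm (∑ i, _)]
      rfl
    -- The singled-out sample is integrated first, the others being part of `H`. The order is
    -- swapped back once it has been linearized, so that the induction hypothesis applies for each
    -- fixed value of it.
    rw [lintegral_congr e, hsplit, lintegral_prod_symm _ hG.aemeasurable]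
    have key : ∀ z : Ω, ‖X z‖ ≤ q →
        2⁻¹ * (ENNReal.ofReal (2 * Real.cosh (r * ‖S + (2 : ℝ) • X z‖) * Real.cosh (2 * r * q) ^ n)
          + ENNReal.ofReal (2 * Real.cosh (r * ‖S - (2 : ℝ) • X z‖) * Real.cosh (2 * r * q) ^ n))
        ≤ ENNReal.ofReal (2 * Real.cosh (r * ‖S‖) * Real.cosh (2 * r * q) ^ (n + 1)) := by
      intro z hz
      have hc : ∀ x, 0 ≤ Real.cosh x := fun x => (Real.cosh_pos x).le
      rw [← ENNReal.ofReal_add (mul_nonneg (mul_nonneg zero_le_two (hc _)) (pow_nonneg (hc _) _))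
        (mul_nonneg (mul_nonneg zero_le_two (hc _)) (pow_nonneg (hc _) _))]
      rw [show (2⁻¹ : ℝ≥0∞) = ENNReal.ofReal 2⁻¹ by
        rw [ENNReal.ofReal_inv_of_pos (by norm_num)]; simp, ← ENNReal.ofReal_mul (by norm_num)]
      refine ENNReal.ofReal_le_ofReal ?_
      have h := cosh_norm_add_add_cosh_norm_sub_le (r • S) (r • (2 : ℝ) • X z)
      rw [← smul_add, ← smul_sub] at h
      simp only [norm_smul, Real.norm_eq_abs, abs_of_nonneg hr, abs_two] at h
      have h2 : Real.cosh (r * (2 * ‖X z‖)) ≤ Real.cosh (2 * r * q) := by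
        rw [Real.cosh_le_cosh, abs_of_nonneg (by positivity)]
        refine le_trans ?_ (le_abs_self _)
        nlinarith
      have h3 : Real.cosh (r * ‖S‖) * Real.cosh (r * (2 * ‖X z‖))
          ≤ Real.cosh (r * ‖S‖) * Real.cosh (2 * r * q) := mul_le_mul_of_nonneg_left h2 (hc _)
      have h4 : 0 ≤ Real.cosh (2 * r * q) ^ n := pow_nonneg (hc _) _
      rw [pow_succ]
      nlinarith
    have hm' : ∀ s : ℝ, Measurable fun p : (Fin n → Ω) × Ω => ⨆ t, eexp (inner ℝ (v t) S +
        ∑ i, (∫ z', f t z' ∂P - f t (p.1 i)) + s * inner ℝ (v t) (X p.2)) := fun s =>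
      Measurable.iSup fun t => measurable_eexp.comp
        ((((hm t).comp measurable_fst).const_add _).add
          (((hLm t).comp measurable_snd).const_mul _))
    have hx : ∀ x : Ω, ‖X x‖ ≤ q → ∫⁻ y : Fin n → Ω, 2⁻¹ * ((⨆ t, eexp (inner ℝ (v t) S +
            ∑ i, (∫ z', f t z' ∂P - f t (y i)) + 2 * inner ℝ (v t) (X x)))
          + ⨆ t, eexp (inner ℝ (v t) S +
            ∑ i, (∫ z', f t z' ∂P - f t (y i)) + (-2) * inner ℝ (v t) (X x)))
          ∂(Measure.pi fun _ => P)
        ≤ ENNReal.ofReal (2 * Real.cosh (r * ‖S‖) * Real.cosh (2 * r * q) ^ (n + 1)) := by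
      intro x hx
      have a : ∀ s : ℝ, Measurable fun y : Fin n → Ω => ⨆ t, eexp (inner ℝ (v t) S +
          ∑ i, (∫ z', f t z' ∂P - f t (y i)) + s * inner ℝ (v t) (X x)) := fun s =>
        Measurable.iSup fun t => measurable_eexp.comp (((hm t).const_add _).add_const _)
      rw [lintegral_const_mul _ ((a 2).fun_add (a (-2))), lintegral_add_left (a 2)]
      refine le_trans (mul_le_mul_right (add_le_add ?_ ?_) _) (key x hx)
      · refine le_trans (le_of_eq ?_) (ih (S + (2 : ℝ) • X x))
        refine lintegral_congr fun y => iSup_congr fun t => ?_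
        rw [inner_add_right, inner_smul_right]
        congr 1; ring
      · refine le_trans (le_of_eq ?_) (ih (S - (2 : ℝ) • X x))
        refine lintegral_congr fun y => iSup_congr fun t => ?_
        rw [inner_sub_right, inner_smul_right]
        congr 1; ring
    have hone : ∀ y : Fin n → Ω, _ := fun y => lintegral_iSup_eexp_le (P := P)
      (H := fun t => inner ℝ (v t) S + ∑ i, (∫ z', f t z' ∂P - f t (y i)))
      (L := fun t z => inner ℝ (v t) (X z)) hf hB hfL hfL'
    refine le_trans (lintegral_mono hone) ?_
    have hs : ∀ a b : ℝ, a - 2 * b = a + (-2) * b := fun a b => by ring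
    simp only [hs]
    rw [lintegral_lintegral_swap (((hm' 2).fun_add (hm' (-2))).const_mul _).aemeasurable]
    refine (lintegral_mono_ae (hXq.mono hx)).trans_eq ?_
    rw [lintegral_const, measure_univ, mul_one]

theorem measure_pi_exists_lt_sum_le_of_countable {ι : Type*} [Nonempty ι] [Countable ι]
    {f : ι → Ω → ℝ} {v : ι → E} {X : Ω → E} {r q η : ℝ} (hr : 0 < r) (hq : 0 < q) (hη : 0 < η)
    (hf : ∀ t, Measurable (f t)) (hX : Measurable X)
    (hv : ∀ t, ‖v t‖ ≤ r) (hXq : ∀ᵐ z ∂P, ‖X z‖ ≤ q)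
    (hfL : ∀ᵐ z ∂P, ∀ t, |f t z| ≤ |inner ℝ (v t) (X z)|)
    (hfL' : ∀ᵐ z ∂P, ∀ s t, |f s z - f t z| ≤ |inner ℝ (v s) (X z) - inner ℝ (v t) (X z)|)
    (n : ℕ) :
    (Measure.pi fun _ : Fin n => P) {z | ∃ t, n * η < ∑ i, (∫ z', f t z' ∂P - f t (z i))}
      ≤ ENNReal.ofReal (2 * Real.exp (-(n * η ^ 2 / (8 * r ^ 2 * q ^ 2)))) := by
  -- The Chernoff parameter minimizing `2 s² r² q² - s η`, the exponent per sample after `cosh x ≤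
  -- exp (x²/2)`.
  set s : ℝ := η / (4 * r ^ 2 * q ^ 2) with hs
  have hs0 : 0 < s := by positivity
  have habs : |s| = s := abs_of_pos hs0
  have hlin := lintegral_pi_iSup_eexp_le (P := P) (f := fun t z => s * f t z)
    (v := fun t => s • v t) (X := X) (r := s * r) (q := q) (by positivity)
    (fun t => (hf t).const_mul s) hX
    (fun t => by
      rw [norm_smul, Real.norm_eq_abs, habs]
      exact mul_le_mul_of_nonneg_left (hv t) hs0.le) hXq
    (by
      filter_upwards [hfL] with z hz t
      rw [real_inner_smul_left, abs_mul, abs_mul]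
      exact mul_le_mul_of_nonneg_left (hz t) (abs_nonneg _))
    (by
      filter_upwards [hfL'] with z hz t t'
      rw [real_inner_smul_left, real_inner_smul_left, ← mul_sub, ← mul_sub, abs_mul, abs_mul]
      exact mul_le_mul_of_nonneg_left (hz t t') (abs_nonneg _)) n 0
  have hm : Measurable fun z : Fin n → Ω => ⨆ t, eexp (inner ℝ (s • v t) (0 : E) +
      ∑ i, (∫ z', s * f t z' ∂P - s * f t (z i))) :=
    Measurable.iSup fun t => measurable_eexp.comp (Measurable.const_add
      (Finset.measurable_fun_sum _ fun i _ =>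
        (((hf t).comp (measurable_pi_apply i)).const_mul s).const_sub _) _)
  have hsub : {z : Fin n → Ω | ∃ t, n * η < ∑ i, (∫ z', f t z' ∂P - f t (z i))}
      ⊆ {z | eexp (s * (n * η)) ≤ ⨆ t, eexp (inner ℝ (s • v t) (0 : E) +
      ∑ i, (∫ z', s * f t z' ∂P - s * f t (z i)))} := by
    rintro z ⟨t, ht⟩
    refine le_trans (eexp_mono ?_) (le_iSup (fun t => eexp (inner ℝ (s • v t) (0 : E) +
      ∑ i, (∫ z', s * f t z' ∂P - s * f t (z i)))) t)
    simp only [integral_const_mul, ← mul_sub, ← Finset.mul_sum, inner_zero_right, zero_add]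
    exact mul_le_mul_of_nonneg_left ht.le hs0.le
  refine (measure_mono hsub).trans ((meas_ge_le_lintegral_div hm.aemeasurable
    (by simp [eexp, Real.exp_pos]) (by simp [eexp])).trans ?_)
  refine (ENNReal.div_le_div_right hlin _).trans ?_
  rw [eexp, ← ENNReal.ofReal_div_of_pos (Real.exp_pos _)]
  refine ENNReal.ofReal_le_ofReal ?_
  rw [norm_zero, mul_zero, Real.cosh_zero, mul_one, mul_div_assoc]
  refine mul_le_mul_of_nonneg_left ?_ zero_le_two
  rw [div_le_iff₀ (Real.exp_pos _), ← Real.exp_add]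
  calc Real.cosh (2 * (s * r) * q) ^ n ≤ Real.exp ((2 * (s * r) * q) ^ 2 / 2) ^ n :=
        pow_le_pow_left₀ (Real.cosh_pos _).le (Real.cosh_le_exp_half_sq _) n
    _ = _ := by
        rw [← Real.exp_nat_mul]
        congr 1
        rw [hs]
        field_simp
        ring

/-- A uniform deviation bound, without dependence on the dimension, for losses that are
contractions of linear functionals. -/
theorem measure_pi_exists_mem_closedBall_lt_sum_le {ℓ : E → Ω → ℝ} {X : Ω → E} {r q η : ℝ} (w₀ : E)
    (hr : 0 < r) (hq : 0 < q) (hη : 0 < η) (hℓ : ∀ w, Measurable (ℓ w)) (hX : Measurable X)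
    (hcont : ∀ z, Continuous fun w => ℓ w z) (hXq : ∀ᵐ z ∂P, ‖X z‖ ≤ q)
    (hLip : ∀ᵐ z ∂P, ∀ a b, |ℓ a z - ℓ b z| ≤ |inner ℝ (a - b) (X z)|) (n : ℕ) :
    (Measure.pi fun _ : Fin n => P) {z | ∃ w ∈ Metric.closedBall w₀ r,
        n * η < ∑ i, (∫ z', (ℓ w z' - ℓ w₀ z') ∂P - (ℓ w (z i) - ℓ w₀ (z i)))}
      ≤ ENNReal.ofReal (2 * Real.exp (-(n * η ^ 2 / (8 * r ^ 2 * q ^ 2)))) := by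
  have : Nonempty (Metric.closedBall w₀ r) := ⟨⟨w₀, Metric.mem_closedBall_self hr.le⟩⟩
  -- The strict inequality is an open condition on `w`, so a violation anywhere in the ball also
  -- occurs at a point of a dense sequence.
  let D := TopologicalSpace.denseSeq (Metric.closedBall w₀ r)
  have hball : ∀ w : Metric.closedBall w₀ r, ‖(w : E) - w₀‖ ≤ r := fun w =>
    mem_closedBall_iff_norm.1 w.2
  have hint : Continuous fun w : Metric.closedBall w₀ r => ∫ z', (ℓ w z' - ℓ w₀ z') ∂P := by
    refine continuous_of_dominated (bound := fun _ => r * q)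
      (fun w => ((hℓ w).sub (hℓ w₀)).aestronglyMeasurable) (fun w => ?_) (integrable_const _)
      (Filter.Eventually.of_forall fun z => ?_)
    · filter_upwards [hLip, hXq] with z h1 h2
      rw [Real.norm_eq_abs]
      exact (h1 w w₀).trans ((abs_real_inner_le_norm _ _).trans
        (mul_le_mul (hball w) h2 (norm_nonneg _) hr.le))
    · exact ((hcont z).comp continuous_subtype_val).sub continuous_const
  refine (measure_mono ?_).trans (measure_pi_exists_lt_sum_le_of_countable (P := P) (X := X)
    (f := fun k : ℕ => fun z => ℓ (D k) z - ℓ w₀ z) (v := fun k => (D k : E) - w₀) hr hq hη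
    (fun k => (hℓ _).sub (hℓ _)) hX (fun k => hball _) hXq ?_ ?_ n)
  · rintro z ⟨w, hw, hlt⟩
    have hc : Continuous fun w : Metric.closedBall w₀ r =>
        ∑ i, (∫ z', (ℓ w z' - ℓ w₀ z') ∂P - (ℓ w (z i) - ℓ w₀ (z i))) :=
      continuous_finsetSum _ fun i _ => hint.sub
        (((hcont (z i)).comp continuous_subtype_val).sub continuous_const)
    exact (TopologicalSpace.denseRange_denseSeq (Metric.closedBall w₀ r)).exists_mem_open
      (isOpen_lt continuous_const hc) ⟨⟨w, hw⟩, hlt⟩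
  · filter_upwards [hLip] with z hz k using hz _ _
  · filter_upwards [hLip] with z hz k k'
    rw [← inner_sub_left, sub_sub_sub_cancel_right, sub_sub_sub_cancel_right]
    exact hz _ _

end Concentration

/-! ### Normalization and tail of the noise. -/

section Noise

theorem integrable_exp_neg_mul_norm {E : Type*} [NormedAddCommGroup E] [NormedSpace ℝ E]
    [FiniteDimensional ℝ E] [MeasurableSpace E] [BorelSpace E] (μ : Measure E)
    [μ.IsAddHaarMeasure] {c : ℝ} (hc : 0 < c) :
    Integrable (fun b : E => Real.exp (-(c * ‖b‖))) μ := by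
  set N := Module.finrank ℝ E + 1
  have hN : (Module.finrank ℝ E : ℝ) < (N : ℝ) := by simp [N]
  -- The bound `y ^ N / N! ≤ exp y` at `y = c (1 + ‖b‖)` gives an integrable polynomial majorant, as
  -- `N` exceeds the dimension.
  refine ((integrable_one_add_norm (μ := μ) hN).const_mul
    (Real.exp c * (N.factorial : ℝ) / c ^ N)).mono' (by fun_prop) ?_
  filter_upwards with b
  have h0 : 0 < 1 + ‖b‖ := by positivity
  rw [Real.norm_eq_abs, Real.abs_exp, Real.rpow_neg h0.le, Real.rpow_natCast]
  have h := Real.pow_div_factorial_le_exp (c * (1 + ‖b‖)) (by positivity) N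
  have hsplit : Real.exp (c * (1 + ‖b‖)) = Real.exp c * Real.exp (c * ‖b‖) := by
    rw [← Real.exp_add]; ring_nf
  rw [hsplit, div_le_iff₀ (by positivity), mul_pow] at h
  rw [Real.exp_neg, ← div_eq_mul_inv, div_div, inv_le_comm₀ (Real.exp_pos _) (by positivity),
    inv_div, div_le_iff₀ (by positivity)]
  linarith

theorem integral_exp_neg_half_mul_norm (ι : Type) [Fintype ι] (c : ℝ) :
    ∫ b : EuclideanSpace ℝ ι, Real.exp (-(c / 2 * ‖b‖))
      = 2 ^ Fintype.card ι * ∫ b : EuclideanSpace ℝ ι, Real.exp (-(c * ‖b‖)) := by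
  have h := Measure.integral_comp_smul (volume : Measure (EuclideanSpace ℝ ι))
    (fun b => Real.exp (-(c * ‖b‖))) (1 / 2)
  rw [finrank_euclideanSpace, ← inv_pow, smul_eq_mul] at h
  norm_num [norm_smul] at h
  rw [← h]
  congr 1 with b
  ring_nf

variable {ι : Type} [Fintype ι] {β : ℝ}

theorem isProbabilityMeasure_noiseLaw (hβ : 0 < β) : IsProbabilityMeasure (noiseLaw ι β) := by
  have hi := integrable_exp_neg_mul_norm (volume : Measure (EuclideanSpace ℝ ι)) (half_pos hβ)
  constructor
  simp only [noiseLaw, Measure.smul_apply, smul_eq_mul]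
  rw [withDensity_apply _ MeasurableSet.univ, Measure.restrict_univ,
    ← ofReal_integral_eq_lintegral_ofReal hi (by filter_upwards with b using Real.exp_nonneg _)]
  exact ENNReal.inv_mul_cancel (by simpa using integral_exp_pos hi) ENNReal.ofReal_ne_top

/-- Half of the exponent pays for the tail. The other half is integrated over the whole space, where
dilation by two costs the factor `2 ^ card ι` relative to the normalization. -/
theorem noiseLaw_lt_norm_le (hβ : 0 < β) (ρ : ℝ) :
    noiseLaw ι β {b | ρ < ‖b‖}
      ≤ ENNReal.ofReal (2 ^ Fintype.card ι * Real.exp (-(β / 4 * ρ))) := by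
  have hi := integrable_exp_neg_mul_norm (volume : Measure (EuclideanSpace ℝ ι)) (half_pos hβ)
  have hi' := integrable_exp_neg_mul_norm (volume : Measure (EuclideanSpace ℝ ι))
    (half_pos (half_pos hβ))
  set Z := ∫ b : EuclideanSpace ℝ ι, Real.exp (-(β / 2 * ‖b‖)) with hZ
  have hZ0 : 0 < Z := integral_exp_pos hi
  have hms : MeasurableSet {b : EuclideanSpace ℝ ι | ρ < ‖b‖} :=
    measurableSet_lt measurable_const measurable_norm
  simp only [noiseLaw, Measure.smul_apply, smul_eq_mul]
  rw [withDensity_apply _ MeasurableSet.univ, Measure.restrict_univ, withDensity_apply _ hms,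
    ← ofReal_integral_eq_lintegral_ofReal hi (by filter_upwards with b using Real.exp_nonneg _),
    ← hZ]
  have hbound : ∫⁻ b in {b : EuclideanSpace ℝ ι | ρ < ‖b‖},
      ENNReal.ofReal (Real.exp (-(β / 2 * ‖b‖)))
      ≤ ENNReal.ofReal (Real.exp (-(β / 4 * ρ)) * (2 ^ Fintype.card ι * Z)) := by
    rw [hZ, ← integral_exp_neg_half_mul_norm, ← integral_const_mul,
      ofReal_integral_eq_lintegral_ofReal (hi'.const_mul _)
        (by filter_upwards with b using by positivity)]
    refine le_trans (setLIntegral_mono' hms fun b hb => ?_) (setLIntegral_le_lintegral _ _)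
    refine ENNReal.ofReal_le_ofReal ?_
    rw [← Real.exp_add]
    refine Real.exp_le_exp.2 ?_
    have : ρ < ‖b‖ := hb
    nlinarith
  refine (mul_le_mul_right hbound _).trans_eq ?_
  rw [← ENNReal.ofReal_inv_of_pos hZ0, ← ENNReal.ofReal_mul (by positivity)]
  congr 1
  field_simp

end Noise

/-! ### Convexity and Lipschitz continuity of the logistic loss. -/

section Logistic

theorem hasDerivAt_log_one_add_exp (x : ℝ) :
    HasDerivAt (fun t => Real.log (1 + Real.exp t)) (Real.sigmoid x) x := by
  have h := ((Real.hasDerivAt_exp x).const_add 1).log (by positivity)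
  convert! h using 1
  rw [Real.sigmoid_def, Real.exp_neg]
  have := Real.exp_pos x
  field_simp
  ring

theorem convexOn_log_one_add_exp : ConvexOn ℝ Set.univ fun t => Real.log (1 + Real.exp t) := by
  refine Monotone.convexOn_univ_of_deriv
    (fun x => (hasDerivAt_log_one_add_exp x).differentiableAt) ?_
  have : deriv (fun t => Real.log (1 + Real.exp t)) = Real.sigmoid :=
    funext fun x => (hasDerivAt_log_one_add_exp x).deriv
  rw [this]
  exact Real.sigmoid_monotone

theorem lipschitzWith_log_one_add_exp : LipschitzWith 1 fun t => Real.log (1 + Real.exp t) := by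
  refine lipschitzWith_of_nnnorm_deriv_le
    (fun x => (hasDerivAt_log_one_add_exp x).differentiableAt) fun x => ?_
  rw [(hasDerivAt_log_one_add_exp x).deriv, ← NNReal.coe_le_coe, coe_nnnorm, Real.norm_eq_abs,
    abs_of_nonneg (Real.sigmoid_nonneg x)]
  exact Real.sigmoid_le_one x

theorem logisticLoss_nonneg (a y : ℝ) : 0 ≤ logisticLoss a y :=
  Real.log_nonneg (by linarith [Real.exp_pos (-y * a)])

theorem continuous_logisticLoss : Continuous fun p : ℝ × ℝ => logisticLoss p.1 p.2 := by
  unfold logisticLoss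
  refine Continuous.log (by fun_prop) fun p => ?_
  have := Real.exp_pos (-p.2 * p.1)
  positivity

theorem abs_logisticLoss_sub_le {y : ℝ} (hy : y = 1 ∨ y = -1) (a b : ℝ) :
    |logisticLoss a y - logisticLoss b y| ≤ |a - b| := by
  have h := lipschitzWith_log_one_add_exp.dist_le_mul (-y * a) (-y * b)
  rw [Real.dist_eq, Real.dist_eq, ← mul_sub, abs_mul] at h
  rcases hy with rfl | rfl <;> simpa [logisticLoss] using h

variable {E : Type*} [NormedAddCommGroup E] [InnerProductSpace ℝ E]

theorem convexOn_logisticLoss_inner (x : E) (y : ℝ) :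
    ConvexOn ℝ Set.univ fun w : E => logisticLoss (inner ℝ w x) y :=
  convexOn_log_one_add_exp.comp_linearMap ((-y) • (innerₗ E).flip x)

theorem continuous_logisticLoss_inner (x : E) (y : ℝ) :
    Continuous fun w : E => logisticLoss (inner ℝ w x) y :=
  continuous_logisticLoss.comp ((continuous_id.inner continuous_const).prodMk continuous_const)

/-! ### Regularized convex minimization and localization. -/

/-- A continuous nonnegative function has a minimizer after a linear perturbation and a quadratic
regularization. -/
theorem exists_isMinOn_add_inner_add_sq [FiniteDimensional ℝ E] {φ : E → ℝ} (hφ : Continuous φ)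
    (hφ0 : ∀ w, 0 ≤ φ w) (b u : E) {l : ℝ} (hl : 0 < l) :
    ∃ w, IsMinOn (fun w => φ w + inner ℝ b w + l / 2 * ‖w - u‖ ^ 2) Set.univ w := by
  have hc : Continuous fun w => φ w + inner ℝ b w + l / 2 * ‖w - u‖ ^ 2 := by fun_prop
  set M := l * ‖u‖ + ‖b‖ with hM
  -- Coercivity by completing the square; `M + 1` in place of `M` leaves a spare `‖w‖`.
  have hlow : ∀ w, ‖w‖ + -((M + 1) ^ 2 / (2 * l)) ≤ φ w + inner ℝ b w + l / 2 * ‖w - u‖ ^ 2 := by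
    intro w
    have h1 := neg_le_of_abs_le (abs_real_inner_le_norm b w)
    have h2 : ‖w - u‖ ^ 2 ≥ ‖w‖ ^ 2 - 2 * (‖w‖ * ‖u‖) := by
      rw [norm_sub_sq_real]
      nlinarith [real_inner_le_norm w u, sq_nonneg ‖u‖]
    have h3 : l / 2 * ‖w - u‖ ^ 2 ≥ l / 2 * (‖w‖ ^ 2 - 2 * (‖w‖ * ‖u‖)) :=
      mul_le_mul_of_nonneg_left h2 (by positivity)
    have h4 : l / 2 * ‖w‖ ^ 2 - (M + 1) * ‖w‖ + (M + 1) ^ 2 / (2 * l)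
        = (l * ‖w‖ - (M + 1)) ^ 2 / (2 * l) := by field_simp; ring
    have h5 : 0 ≤ (l * ‖w‖ - (M + 1)) ^ 2 / (2 * l) := by positivity
    have h6 := hφ0 w
    have h7 : M * ‖w‖ = l * (‖w‖ * ‖u‖) + ‖b‖ * ‖w‖ := by rw [hM]; ring
    nlinarith
  obtain ⟨w, hw⟩ := hc.exists_forall_le (Filter.tendsto_atTop_mono hlow
    (Filter.tendsto_atTop_add_const_right _ _ tendsto_norm_cocompact_atTop))
  exact ⟨w, fun w' _ => hw w'⟩

theorem norm_midpoint_sq (a b : E) :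
    ‖(1 / 2 : ℝ) • a + (1 / 2 : ℝ) • b‖ ^ 2
      = 1 / 2 * ‖a‖ ^ 2 + 1 / 2 * ‖b‖ ^ 2 - 1 / 4 * ‖a - b‖ ^ 2 := by
  rw [norm_add_sq_real, norm_sub_sq_real, norm_smul, norm_smul, real_inner_smul_left,
    real_inner_smul_right]
  norm_num
  ring

/-- Quadratic growth at the minimizer of a regularized convex function. -/
theorem quadratic_growth_of_isMinOn {φ : E → ℝ} (hφ : ConvexOn ℝ Set.univ φ) {u w₀ : E} {l : ℝ}
    (h : IsMinOn (fun w => φ w + l / 2 * ‖w - u‖ ^ 2) Set.univ w₀) (w : E) :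
    l / 4 * ‖w - w₀‖ ^ 2 ≤ (φ w + l / 2 * ‖w - u‖ ^ 2) - (φ w₀ + l / 2 * ‖w₀ - u‖ ^ 2) := by
  -- Minimality is tested only at the midpoint, whence `l / 4` rather than the sharp `l / 2`.
  have h1 := h (Set.mem_univ ((1 / 2 : ℝ) • w + (1 / 2 : ℝ) • w₀))
  have h2 := hφ.2 (Set.mem_univ w) (Set.mem_univ w₀) (by norm_num : (0 : ℝ) ≤ 1 / 2)
    (by norm_num : (0 : ℝ) ≤ 1 / 2) (by norm_num)
  have h3 := norm_midpoint_sq (w - u) (w₀ - u)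
  have e : (1 / 2 : ℝ) • (w - u) + (1 / 2 : ℝ) • (w₀ - u)
      = (1 / 2 : ℝ) • w + (1 / 2 : ℝ) • w₀ - u := by module
  rw [e, sub_sub_sub_cancel_right] at h3
  simp only [Set.mem_ofPred_eq, smul_eq_mul] at h1 h2
  rw [h3] at h1
  linarith

theorem convexOn_add_inner_add_sq {φ : E → ℝ} (hφ : ConvexOn ℝ Set.univ φ) (b u : E) {l : ℝ}
    (hl : 0 ≤ l) : ConvexOn ℝ Set.univ fun w => φ w + inner ℝ b w + l / 2 * ‖w - u‖ ^ 2 := by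
  have h1 : ConvexOn ℝ Set.univ fun w : E => inner ℝ b w :=
    (innerₗ E b).convexOn convex_univ
  have h2 : ConvexOn ℝ Set.univ fun w : E => ‖w - u‖ := by
    simpa [dist_eq_norm] using convexOn_dist u (convex_univ (𝕜 := ℝ) (E := E))
  have h3 : ConvexOn ℝ Set.univ fun w : E => ‖w - u‖ ^ 2 := h2.pow (fun _ _ => norm_nonneg _) 2
  exact (hφ.add h1).add (h3.smul (by positivity : 0 ≤ l / 2))

/-- If the regularized population and perturbed empirical objectives differ little on a ball
around the minimizer `w₀` of the former, then the minimizer `w` of the latter is nearly optimal. -/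
theorem objective_sub_le_of_isMinOn {φ ψ : E → ℝ} (hφ : ConvexOn ℝ Set.univ φ)
    (hψ : ConvexOn ℝ Set.univ ψ) {b u w w₀ : E} {l r η β : ℝ} (hl : 0 ≤ l) (hr : 0 < r)
    (hw₀ : IsMinOn (fun w => φ w + l / 2 * ‖w - u‖ ^ 2) Set.univ w₀)
    (hw : IsMinOn (fun w => ψ w + inner ℝ b w + l / 2 * ‖w - u‖ ^ 2) Set.univ w)
    (hdev : ∀ t ∈ Metric.closedBall w₀ r, (φ t - φ w₀) - (ψ t - ψ w₀) ≤ η)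
    (hb : ‖b‖ ≤ β) (hsmall : η + β * r < l / 4 * r ^ 2) :
    (φ w + l / 2 * ‖w - u‖ ^ 2) - (φ w₀ + l / 2 * ‖w₀ - u‖ ^ 2) ≤ η + β * r := by
  have key : ∀ t ∈ Metric.closedBall w₀ r,
      ψ t + inner ℝ b t + l / 2 * ‖t - u‖ ^ 2 ≤ ψ w₀ + inner ℝ b w₀ + l / 2 * ‖w₀ - u‖ ^ 2 →
      (φ t + l / 2 * ‖t - u‖ ^ 2) - (φ w₀ + l / 2 * ‖w₀ - u‖ ^ 2) ≤ η + β * r := by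
    intro t ht hle
    have h1 := hdev t ht
    have h2 : -(β * r) ≤ inner ℝ b t - inner ℝ b w₀ := by
      rw [← inner_sub_right]
      refine le_trans ?_ (neg_le_of_abs_le (abs_real_inner_le_norm b (t - w₀)))
      have ht' : ‖t - w₀‖ ≤ r := by simpa [dist_eq_norm] using ht
      have := mul_le_mul hb ht' (norm_nonneg _) ((norm_nonneg _).trans hb)
      linarith
    linarith
  by_cases hin : w ∈ Metric.closedBall w₀ r
  · exact key w hin (hw (Set.mem_univ w₀))
  · exfalso
    have hlt : r < ‖w - w₀‖ := by simpa [dist_eq_norm] using hin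
    have hpos : 0 < ‖w - w₀‖ := hr.trans hlt
    -- The segment from `w₀` to `w` meets the sphere of radius `r` at a point where, by convexity,
    -- the perturbed objective is still at most its value at `w₀`. There `key` contradicts quadratic
    -- growth.
    set τ := r / ‖w - w₀‖ with hτ
    have hτ0 : 0 ≤ τ := by positivity
    have hτ1 : τ ≤ 1 := (div_le_one hpos).2 hlt.le
    set t := (1 - τ) • w₀ + τ • w with ht
    have htw : t - w₀ = τ • (w - w₀) := by rw [ht]; module
    have hnorm : ‖t - w₀‖ = r := by
      rw [htw, norm_smul, Real.norm_eq_abs, abs_of_nonneg hτ0, hτ, div_mul_cancel₀ _ hpos.ne']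
    have hconv := (convexOn_add_inner_add_sq hψ b u hl).2 (Set.mem_univ w₀) (Set.mem_univ w)
      (sub_nonneg.2 hτ1) hτ0 (by ring)
    have hmin := hw (Set.mem_univ w₀)
    simp only [Set.mem_ofPred_eq, smul_eq_mul] at hconv hmin
    have hle := key t (by simp [dist_eq_norm, hnorm]) (hconv.trans (by nlinarith))
    have hg := quadratic_growth_of_isMinOn hφ hw₀ t
    rw [hnorm] at hg
    linarith

/-! ### Expected logistic loss and the good sampling event. -/

section Expectation

variable {Ω : Type*} [MeasurableSpace Ω] {P : Measure Ω} [IsProbabilityMeasure P]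
  [FiniteDimensional ℝ E] [MeasurableSpace E] [BorelSpace E] {X : Ω → E} {Y : Ω → ℝ} {q : ℝ}

theorem measurable_logisticLoss_inner (hX : Measurable X) (hY : Measurable Y) (w : E) :
    Measurable fun z => logisticLoss (inner ℝ w (X z)) (Y z) :=
  continuous_logisticLoss.measurable.comp (hX.const_inner.prodMk hY)

theorem integrable_logisticLoss_inner (hX : Measurable X) (hY : Measurable Y)
    (hXq : ∀ᵐ z ∂P, ‖X z‖ ≤ q) (hY1 : ∀ᵐ z ∂P, Y z = 1 ∨ Y z = -1) (w : E) :
    Integrable (fun z => logisticLoss (inner ℝ w (X z)) (Y z)) P := by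
  refine Integrable.of_bound (measurable_logisticLoss_inner hX hY w).aestronglyMeasurable
    (Real.log 2 + ‖w‖ * q) ?_
  filter_upwards [hXq, hY1] with z h1 h2
  have h3 := abs_logisticLoss_sub_le h2 (inner ℝ w (X z)) 0
  have h4 : logisticLoss 0 (Y z) = Real.log 2 := by simp [logisticLoss, one_add_one_eq_two]
  have h5 := abs_real_inner_le_norm w (X z)
  have h6 : ‖w‖ * ‖X z‖ ≤ ‖w‖ * q := mul_le_mul_of_nonneg_left h1 (norm_nonneg _)
  rw [h4, sub_zero] at h3
  rw [Real.norm_eq_abs, abs_of_nonneg (logisticLoss_nonneg _ _)]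
  linarith [(abs_le.1 h3).2]

theorem convexOn_integral_logisticLoss_inner (hX : Measurable X) (hY : Measurable Y)
    (hXq : ∀ᵐ z ∂P, ‖X z‖ ≤ q) (hY1 : ∀ᵐ z ∂P, Y z = 1 ∨ Y z = -1) :
    ConvexOn ℝ Set.univ fun w => ∫ z, logisticLoss (inner ℝ w (X z)) (Y z) ∂P := by
  have hi := integrable_logisticLoss_inner hX hY hXq hY1
  refine ⟨convex_univ, fun a _ b _ s t hs ht hst => ?_⟩
  simp only [smul_eq_mul]
  rw [← integral_const_mul, ← integral_const_mul,
    ← integral_add ((hi a).const_mul s) ((hi b).const_mul t)]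
  refine integral_mono (hi _) (((hi a).const_mul s).add ((hi b).const_mul t)) fun z => ?_
  exact (convexOn_logisticLoss_inner (X z) (Y z)).2 (Set.mem_univ a) (Set.mem_univ b) hs ht hst

theorem continuous_integral_logisticLoss_inner (hX : Measurable X) (hY : Measurable Y)
    (hXq : ∀ᵐ z ∂P, ‖X z‖ ≤ q) (hY1 : ∀ᵐ z ∂P, Y z = 1 ∨ Y z = -1) :
    Continuous fun w => ∫ z, logisticLoss (inner ℝ w (X z)) (Y z) ∂P := by
  have hi := integrable_logisticLoss_inner hX hY hXq hY1
  refine (LipschitzWith.of_dist_le' (K := q) fun a b => ?_).continuous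
  rw [Real.dist_eq, ← Real.norm_eq_abs, ← integral_sub (hi a) (hi b)]
  refine (norm_integral_le_of_norm_le_const (C := q * dist a b) ?_).trans_eq (by simp)
  filter_upwards [hXq, hY1] with z h1 h2
  refine (abs_logisticLoss_sub_le h2 _ _).trans ?_
  rw [← inner_sub_left, dist_eq_norm, mul_comm]
  exact (abs_real_inner_le_norm _ _).trans (mul_le_mul_of_nonneg_left h1 (norm_nonneg _))

/-- Outside an event of small probability, every minimizer of the empirical objective with a small
linear perturbation has an expected loss close to that of the reference parameter `v`. -/
theorem exists_event_integral_logisticLoss_le (hX : Measurable X) (hY : Measurable Y)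
    (hXq : ∀ᵐ z ∂P, ‖X z‖ ≤ q) (hY1 : ∀ᵐ z ∂P, Y z = 1 ∨ Y z = -1) (hq : 0 < q)
    {n : ℕ} (hn : 0 < n) {u v : E} (hv : v ≠ 0) {l η β ε : ℝ} (hl : 0 < l) (hη : 0 < η)
    (hsmall : η + β * ‖v‖ < l / 4 * ‖v‖ ^ 2) (hε : η + β * ‖v‖ ≤ ε / 2)
    (hreg : l * ‖v - u‖ ^ 2 ≤ ε) :
    ∃ B : Set (Fin n → Ω),
      (Measure.pi fun _ => P) B
        ≤ ENNReal.ofReal (2 * Real.exp (-(n * η ^ 2 / (8 * ‖v‖ ^ 2 * q ^ 2)))) ∧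
      ∀ z ∉ B, ∀ b w, ‖b‖ ≤ β →
        IsMinOn (fun w => 1 / n * ∑ i, logisticLoss (inner ℝ w (X (z i))) (Y (z i))
          + inner ℝ b w + l / 2 * ‖w - u‖ ^ 2) Set.univ w →
        ∫ z, logisticLoss (inner ℝ w (X z)) (Y z) ∂P
          ≤ ∫ z, logisticLoss (inner ℝ v (X z)) (Y z) ∂P + ε := by
  have hi := integrable_logisticLoss_inner hX hY hXq hY1
  have hconv := convexOn_integral_logisticLoss_inner hX hY hXq hY1
  have hr : 0 < ‖v‖ := norm_pos_iff.2 hv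
  have hn' : (0 : ℝ) < n := Nat.cast_pos.2 hn
  obtain ⟨w₀, hw₀⟩ := exists_isMinOn_add_inner_add_sq
    (continuous_integral_logisticLoss_inner hX hY hXq hY1)
    (fun w => integral_nonneg fun z => logisticLoss_nonneg _ _) 0 u hl
  simp only [inner_zero_left, add_zero] at hw₀
  refine ⟨_, measure_pi_exists_mem_closedBall_lt_sum_le (P := P)
    (ℓ := fun w z => logisticLoss (inner ℝ w (X z)) (Y z)) w₀ hr hq hη
    (measurable_logisticLoss_inner hX hY) hX (fun z => continuous_logisticLoss_inner _ _) hXq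
    ?_ n, ?_⟩
  · filter_upwards [hY1] with z hz a b
    rw [inner_sub_left]
    exact abs_logisticLoss_sub_le hz _ _
  intro z hz b w hb hw
  have hdev : ∀ t ∈ Metric.closedBall w₀ ‖v‖,
      (∫ z, logisticLoss (inner ℝ t (X z)) (Y z) ∂P
        - ∫ z, logisticLoss (inner ℝ w₀ (X z)) (Y z) ∂P)
      - (1 / n * ∑ i, logisticLoss (inner ℝ t (X (z i))) (Y (z i))
        - 1 / n * ∑ i, logisticLoss (inner ℝ w₀ (X (z i))) (Y (z i))) ≤ η := by
    intro t ht
    have h : ¬ _ := fun h => hz ⟨t, ht, h⟩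
    rw [not_lt, integral_sub (hi t) (hi w₀)] at h
    simp only [Finset.sum_sub_distrib, Finset.sum_const, Finset.card_univ, Fintype.card_fin,
      nsmul_eq_mul] at h
    refine le_of_mul_le_mul_left (le_trans (le_of_eq ?_) h) hn'
    field_simp
  have hemp : ConvexOn ℝ Set.univ fun w : E =>
      1 / (n : ℝ) * ∑ i, logisticLoss (inner ℝ w (X (z i))) (Y (z i)) := by
    have h : ConvexOn ℝ Set.univ fun w : E =>
        ∑ i, logisticLoss (inner ℝ w (X (z i))) (Y (z i)) :=
      ⟨convex_univ, fun a _ b _ s t hs ht hst => by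
        simp only [smul_eq_mul, Finset.mul_sum]
        rw [← Finset.sum_add_distrib]
        exact Finset.sum_le_sum fun i _ => (convexOn_logisticLoss_inner (X (z i)) (Y (z i))).2
          (Set.mem_univ a) (Set.mem_univ b) hs ht hst⟩
    exact h.smul (by positivity : (0 : ℝ) ≤ 1 / n)
  have hmain := objective_sub_le_of_isMinOn hconv hemp hl.le hr hw₀ hw hdev hb hsmall
  -- The reference `v` enters only here, through optimality of `w₀`, and in the radius; it need not
  -- lie in the ball.
  have hopt := hw₀ (Set.mem_univ v)
  simp only [Set.mem_ofPred_eq] at hopt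
  have hpos : 0 ≤ l / 2 * ‖w - u‖ ^ 2 := by positivity
  linarith

end Expectation

end Logistic

/-! ### Privacy budget, low-level minimizers and law of the outcome. -/

namespace PSTF

variable {d K : ℕ} (A : PSTF d K)

theorem measurable_groupSample (k : Fin K) : Measurable (A.groupSample k) := by
  have hr : Measurable (A.restrict k) :=
    (WithLp.measurable_toLp 2 _).comp (measurable_pi_lambda _ fun i =>
      (measurable_pi_apply i.1).comp (WithLp.measurable_ofLp 2 _))
  exact (((A.measurable_scale k).comp (hr.comp measurable_fst)).smul
    (hr.comp measurable_fst)).prodMk measurable_snd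

theorem expectedLoss_groupLaw (k : Fin K) (P : Measure (EuclideanSpace ℝ (Fin d) × ℝ))
    (w : A.Model k) :
    expectedLoss w (A.groupLaw k P)
      = ∫ z, logisticLoss (inner ℝ w (A.groupSample k z).1) z.2 ∂P := by
  rw [expectedLoss, groupLaw, integral_map (A.measurable_groupSample k).aemeasurable
    (measurable_logisticLoss_inner measurable_fst measurable_snd w).aestronglyMeasurable]
  rfl

/-- The argument of each logarithm is the square of `1 + q²/(4nλ)`, so `log (1 + x) ≤ x` bounds each
of the `K` terms by `ε/(2K)`. -/
theorem half_eps_le_epsPrime {n : ℕ} (hn : 0 < n)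
    (h : ∀ k, K * A.q k ^ 2 ≤ A.eps * (n * A.lam k)) : A.eps / 2 ≤ A.epsPrime n := by
  have hterm : ∀ k, Real.log (1 + A.q k ^ 2 / (2 * n * A.lam k)
      + A.q k ^ 4 / (16 * (n : ℝ) ^ 2 * A.lam k ^ 2)) ≤ A.eps / 2 / K := by
    intro k
    have hK : (0 : ℝ) < K := Nat.cast_pos.2 k.pos
    have hn' : (0 : ℝ) < n := Nat.cast_pos.2 hn
    have hl := A.lam_pos k
    have e : 1 + A.q k ^ 2 / (2 * n * A.lam k) + A.q k ^ 4 / (16 * (n : ℝ) ^ 2 * A.lam k ^ 2)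
        = (1 + A.q k ^ 2 / (4 * n * A.lam k)) ^ 2 := by
      field_simp
      ring
    have hx : 0 ≤ A.q k ^ 2 / (4 * n * A.lam k) := by positivity
    have hlog := Real.log_le_sub_one_of_pos (by linarith : 0 < 1 + A.q k ^ 2 / (4 * n * A.lam k))
    have hle : A.q k ^ 2 / (4 * n * A.lam k) ≤ A.eps / 4 / K := by
      rw [div_div, div_le_div_iff₀ (by positivity) (by positivity)]
      linarith [h k]
    rw [e, Real.log_pow]
    have e2 : A.eps / 2 / K = 2 * (A.eps / 4 / K) := by ring
    rw [e2]
    push_cast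
    linarith
  have hsum := Finset.sum_le_sum fun k (_ : k ∈ Finset.univ) => hterm k
  rw [Finset.sum_const, Finset.card_univ, Fintype.card_fin, nsmul_eq_mul] at hsum
  have hK : (K : ℝ) * (A.eps / 2 / K) ≤ A.eps / 2 := by
    rcases eq_or_ne (K : ℝ) 0 with hK | hK
    · rw [hK, zero_mul]
      linarith [A.eps_pos]
    · rw [mul_div_cancel₀ _ hK]
  unfold epsPrime
  linarith

theorem objective_eq {n : ℕ} {k : Fin K} {u : A.Model k}
    (hg : A.g k = fun w => 1 / 2 * ‖w - u‖ ^ 2) (hε : 0 < A.epsPrime n)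
    (z : Fin n → EuclideanSpace ℝ (Fin d) × ℝ) (b : A.Model k) :
    A.objective n k z b = fun w =>
      1 / n * ∑ i, logisticLoss (inner ℝ w (A.groupSample k (z i)).1) (z i).2
        + inner ℝ ((1 / n : ℝ) • b) w + A.lam k / 2 * ‖w - u‖ ^ 2 := by
  funext w
  simp only [objective, Delta, if_pos hε, hg, real_inner_smul_left, groupSample]
  ring

theorem isMinOn_lowModel {n : ℕ} {k : Fin K} {u : A.Model k}
    (hg : A.g k = fun w => 1 / 2 * ‖w - u‖ ^ 2) (hε : 0 < A.epsPrime n) (ω : A.Outcome n) :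
    IsMinOn (A.objective n k ω.1 (ω.2 k)) Set.univ (A.lowModel n k ω) := by
  have h : ∃ w, IsMinOn (A.objective n k ω.1 (ω.2 k)) Set.univ w := by
    rw [A.objective_eq hg hε]
    refine exists_isMinOn_add_inner_add_sq (continuous_const.mul
      (continuous_finsetSum _ fun i _ => continuous_logisticLoss_inner _ _)) (fun w => ?_) _ u
      (A.lam_pos k)
    exact mul_nonneg (by positivity) (Finset.sum_nonneg fun i _ => logisticLoss_nonneg _ _)
  exact Classical.epsilon_spec h

theorem card_group_le (k : Fin K) : Fintype.card {i : Fin d // A.group i = k} ≤ d := by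
  simpa using Fintype.card_subtype_le fun i : Fin d => A.group i = k

theorem groups_le (A : PSTF d K) : K ≤ d := by
  simpa using Fintype.card_le_of_surjective _ A.group_surjective

/-- If the importance of a group is zero then all its models have the same expected loss. -/
theorem expectedLoss_eq_of_q_eq_zero {k : Fin K} {P : Measure (EuclideanSpace ℝ (Fin d) × ℝ)}
    (hq : A.q k = 0) (hP : ∀ᵐ z ∂P, ‖(A.groupSample k z).1‖ ≤ A.q k) (w w' : A.Model k) :
    expectedLoss w (A.groupLaw k P) = expectedLoss w' (A.groupLaw k P) := by
  rw [expectedLoss_groupLaw, expectedLoss_groupLaw]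
  refine integral_congr_ae ?_
  filter_upwards [hP] with z hz
  rw [hq, norm_le_zero_iff] at hz
  rw [hz, inner_zero_right, inner_zero_right]

theorem isProbabilityMeasure_outcomeLaw {n : ℕ} (hε : 0 < A.epsPrime n)
    (P : Measure (EuclideanSpace ℝ (Fin d) × ℝ)) [IsProbabilityMeasure P] :
    IsProbabilityMeasure (A.outcomeLaw n P) := by
  have hβ : 0 < A.epsNoise n := by rwa [epsNoise, if_pos hε]
  have := fun k : Fin K =>
    isProbabilityMeasure_noiseLaw (ι := {i : Fin d // A.group i = k}) hβ
  unfold outcomeLaw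
  infer_instance

theorem outcomeLaw_samples_mem {n : ℕ} (hε : 0 < A.epsPrime n)
    (P : Measure (EuclideanSpace ℝ (Fin d) × ℝ)) [IsProbabilityMeasure P]
    (B : Set (Fin n → EuclideanSpace ℝ (Fin d) × ℝ)) :
    A.outcomeLaw n P {ω | ω.1 ∈ B} = (Measure.pi fun _ => P) B := by
  have hβ : 0 < A.epsNoise n := by rwa [epsNoise, if_pos hε]
  have := fun k : Fin K =>
    isProbabilityMeasure_noiseLaw (ι := {i : Fin d // A.group i = k}) hβ
  have e : {ω : A.Outcome n | ω.1 ∈ B} = B ×ˢ Set.univ := by ext; simp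
  rw [e, outcomeLaw, Measure.prod_prod, measure_univ, mul_one]

theorem outcomeLaw_lt_norm_noise_le {n : ℕ} (hε : 0 < A.epsPrime n)
    (P : Measure (EuclideanSpace ℝ (Fin d) × ℝ)) [IsProbabilityMeasure P] (k : Fin K) (ρ : ℝ) :
    A.outcomeLaw n P {ω | ρ < ‖ω.2 k‖} ≤ ENNReal.ofReal
      (2 ^ Fintype.card {i : Fin d // A.group i = k} * Real.exp (-(A.epsPrime n / 4 * ρ))) := by
  have hβ' : A.epsNoise n = A.epsPrime n := by rw [epsNoise, if_pos hε]
  have := fun k : Fin K =>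
    isProbabilityMeasure_noiseLaw (ι := {i : Fin d // A.group i = k}) (hβ'.symm ▸ hε)
  have hms : MeasurableSet {b : A.Model k | ρ < ‖b‖} :=
    measurableSet_lt measurable_const measurable_norm
  have e : {ω : A.Outcome n | ρ < ‖ω.2 k‖}
      = Set.univ ×ˢ (Function.eval k ⁻¹' {b : A.Model k | ρ < ‖b‖}) := by ext; simp
  rw [e, outcomeLaw, Measure.prod_prod, measure_univ, one_mul,
    (measurePreserving_eval _ k).measure_preimage hms.nullMeasurableSet, hβ']
  exact noiseLaw_lt_norm_le hε ρ

end PSTF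

/-- Subadditivity alone is used, so `s` may be nonmeasurable: the low-level model is an arbitrary
choice of minimizer. -/
theorem le_measure_of_compl_subset_union {α : Type*} [MeasurableSpace α] {μ : Measure α}
    [IsProbabilityMeasure μ] {s t₁ t₂ : Set α} {δ : ℝ} (hδ : 0 ≤ δ) (hs : sᶜ ⊆ t₁ ∪ t₂)
    (h₁ : μ t₁ ≤ ENNReal.ofReal (δ / 2)) (h₂ : μ t₂ ≤ ENNReal.ofReal (δ / 2)) :
    ENNReal.ofReal (1 - δ) ≤ μ s := by
  have h : 1 ≤ μ s + ENNReal.ofReal δ := by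
    calc (1 : ℝ≥0∞) = μ (s ∪ sᶜ) := by rw [Set.union_compl_self, measure_univ]
      _ ≤ μ s + μ sᶜ := measure_union_le _ _
      _ ≤ μ s + (μ t₁ + μ t₂) := by
          gcongr
          exact (measure_mono hs).trans (measure_union_le _ _)
      _ ≤ μ s + (ENNReal.ofReal (δ / 2) + ENNReal.ofReal (δ / 2)) := by gcongr
      _ = _ := by rw [← ENNReal.ofReal_add (by linarith) (by linarith), add_halves]
  rw [ENNReal.ofReal_sub _ hδ, ENNReal.ofReal_one]
  exact tsub_le_iff_right.2 h

theorem two_mul_exp_neg_le {δ x : ℝ} (hδ : 0 < δ) (hx : Real.log (4 / δ) ≤ x) :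
    2 * Real.exp (-x) ≤ δ / 2 := by
  have h : Real.exp (-x) ≤ δ / 4 := by
    rw [← Real.le_log_iff_exp_le (by positivity), ← inv_div, Real.log_inv]
    linarith
  linarith

theorem two_pow_mul_exp_neg_le {δ x : ℝ} {m : ℕ} (hδ : 0 < δ)
    (hx : m * Real.log 2 + Real.log (2 / δ) ≤ x) : 2 ^ m * Real.exp (-x) ≤ δ / 2 := by
  have h : Real.exp (-x) ≤ δ / 2 / 2 ^ m := by
    rw [← Real.le_log_iff_exp_le (by positivity), Real.log_div (by positivity) (by positivity),
      Real.log_pow, ← inv_div 2 δ, Real.log_inv]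
    linarith
  rw [le_div_iff₀ (by positivity)] at h
  linarith

/-! ### Absorbing constants into the logarithms. -/

section Constants

variable {δ δ₀ : ℝ}

/-- This is why the constant depends on `δ₀`: additive constants can be absorbed only if `log (1/δ)`
stays away from zero. -/
theorem one_le_inv_log_mul_log (hδ : 0 < δ) (hδδ₀ : δ ≤ δ₀) (hδ₀ : δ₀ < 1) :
    0 < Real.log (1 / δ₀) ∧ 1 ≤ 1 / Real.log (1 / δ₀) * Real.log (1 / δ) := by
  have h₀ : 0 < δ₀ := hδ.trans_le hδδ₀
  have h1 : 0 < Real.log (1 / δ₀) := Real.log_pos ((one_lt_div h₀).2 hδ₀)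
  have h2 : Real.log (1 / δ₀) ≤ Real.log (1 / δ) :=
    Real.log_le_log (by positivity) (one_div_le_one_div_of_le hδ hδδ₀)
  refine ⟨h1, ?_⟩
  rw [one_div_mul_eq_div, one_le_div h1]
  exact h2

theorem log_four_div_le (hδ : 0 < δ) (hδδ₀ : δ ≤ δ₀) (hδ₀ : δ₀ < 1) :
    Real.log (4 / δ) ≤ (2 * (1 / Real.log (1 / δ₀)) + 1) * Real.log (1 / δ) := by
  have h := (one_le_inv_log_mul_log hδ hδδ₀ hδ₀).2
  have e : Real.log (4 / δ) = 2 * Real.log 2 + Real.log (1 / δ) := by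
    rw [show (4 : ℝ) / δ = 2 ^ 2 * (1 / δ) by ring, Real.log_mul (by norm_num) (by positivity),
      Real.log_pow]
    norm_num
  rw [e]
  linarith [Real.log_two_lt_d9]

theorem mul_log_two_add_log_le {d K m : ℕ} (hK : 0 < K) (hKd : K ≤ d) (hm : m ≤ d)
    (hδ : 0 < δ) (hδδ₀ : δ ≤ δ₀) (hδ₀ : δ₀ < 1) :
    m * Real.log 2 + Real.log (2 / δ)
      ≤ (2 * (1 / Real.log (1 / δ₀)) + 1) * (d * Real.log (d / (K * δ))) := by
  obtain ⟨h0, h⟩ := one_le_inv_log_mul_log hδ hδδ₀ hδ₀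
  have hK' : (0 : ℝ) < K := Nat.cast_pos.2 hK
  have hd : (1 : ℝ) ≤ d := Nat.one_le_cast.2 (hK.trans_le hKd)
  have hlog : Real.log (1 / δ) ≤ Real.log (d / (K * δ)) := by
    refine Real.log_le_log (by positivity) ?_
    rw [div_le_div_iff₀ hδ (by positivity)]
    have : (K : ℝ) * δ ≤ d * δ := mul_le_mul_of_nonneg_right (Nat.cast_le.2 hKd) hδ.le
    linarith
  set l := Real.log (d / (K * δ))
  set c := 1 / Real.log (1 / δ₀)
  have hc : 0 < c := by positivity
  have hcl : 1 ≤ c * l := h.trans (mul_le_mul_of_nonneg_left hlog hc.le)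
  have hl : 0 ≤ l := by
    by_contra hneg
    nlinarith
  have e : Real.log (2 / δ) = Real.log 2 + Real.log (1 / δ) := by
    rw [← Real.log_mul (by norm_num) (by positivity)]
    congr 1; ring
  have hm' : m * Real.log 2 ≤ d * (c * l) := by
    have h1 : (m : ℝ) ≤ d := Nat.cast_le.2 hm
    have h2 : Real.log 2 ≤ c * l := by linarith [Real.log_two_lt_d9]
    exact mul_le_mul h1 h2 (Real.log_nonneg (by norm_num)) (by linarith)
  have h2 : c * l ≤ d * (c * l) := le_mul_of_one_le_left (by linarith) hd
  have h3 : l ≤ d * l := le_mul_of_one_le_left hl hd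
  rw [e]
  linarith [Real.log_two_lt_d9]

end Constants

end

/-! ### Choice of constants and assembly. -/

theorem mainTheorem2 (K : ℕ) (R δ₀ : ℝ) (hR : 0 < R) (hδ₀ : δ₀ < 1) :
    ∃ C₁ : ℝ, 0 < C₁ ∧
      ∀ (d : ℕ) (A : PSTF d K) (u v : ∀ k, A.Model k)
        (P : MeasureTheory.Measure (EuclideanSpace ℝ (Fin d) × ℝ))
        (_ : MeasureTheory.IsProbabilityMeasure P) (n : ℕ) (δ εg : ℝ),
        0 < δ → δ ≤ δ₀ → 0 < εg →
        (∀ k, A.g k = fun w => 1 / 2 * ‖w - u k‖ ^ 2) →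
        (∀ᵐ z ∂P, z.2 = 1 ∨ z.2 = -1) →
        (∀ᵐ z ∂P, ∀ k, ‖(A.groupSample k z).1‖ ≤ A.q k) →
        (∀ k, v k ≠ 0) →
        (∀ k, εg / (R * ‖v k‖ ^ 2) ≤ A.lam k ∧ A.lam k * ‖v k - u k‖ ^ 2 ≤ εg) →
        (∀ k, (n : ℝ) > C₁ * max (max
            ((A.q k * ‖v k‖) ^ 2 * Real.log (1 / δ) / εg ^ 2)
            (d * Real.log (d / (K * δ)) * (A.q k * ‖v k‖) / (A.q k * K * εg * A.eps)))
            ((A.q k * ‖v k‖) ^ 2 / (εg * A.eps))) →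
        ∀ k,
          (∀ ω, IsMinOn (A.objective n k ω.1 (ω.2 k)) Set.univ (A.lowModel n k ω)) ∧
          A.outcomeLaw n P
            {ω | expectedLoss (A.lowModel n k ω) (A.groupLaw k P)
              ≤ expectedLoss (v k) (A.groupLaw k P) + εg} ≥ ENNReal.ofReal (1 - δ) := by
  rcases le_or_gt δ₀ 0 with hδ₀' | hδ₀'
  · exact ⟨1, one_pos, fun d A u v P _ n δ εg hδ hδδ₀ => absurd hδ (by linarith)⟩
  have hlog₀ : 0 < Real.log (1 / δ₀) := (one_le_inv_log_mul_log hδ₀' le_rfl hδ₀).1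
  set M : ℝ := 2 * (1 / Real.log (1 / δ₀)) + 1 with hM
  have hM0 : 0 < M := by positivity
  -- `1/2` leaves room for the regularizer at `v`; `1/(8R)` keeps the total error `c εg` strictly
  -- below the growth `εg/(4R)`.
  set c : ℝ := min (1 / 2) (1 / (8 * R)) with hc
  have hc0 : 0 < c := by positivity
  have hc2 : c ≤ 1 / 2 := min_le_left _ _
  have hcR : c ≤ 1 / (8 * R) := min_le_right _ _
  -- The summands serve, in order, `ε' ≥ ε/2`, the sampling event and the noise event, against the
  -- third, first and second terms of the maximum.
  refine ⟨K * R + 32 * M / c ^ 2 + 16 * K * M / c, by positivity, ?_⟩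
  set C₁ : ℝ := K * R + 32 * M / c ^ 2 + 16 * K * M / c with hC₁
  intro d A u v P hP n δ εg hδ hδδ₀ hεg hg hY hX hv hlam hn k
  have hn0 : 0 < n := by
    have h := hn k
    have h' : 0 ≤ C₁ * max (max
            ((A.q k * ‖v k‖) ^ 2 * Real.log (1 / δ) / εg ^ 2)
            (d * Real.log (d / (K * δ)) * (A.q k * ‖v k‖) / (A.q k * K * εg * A.eps)))
            ((A.q k * ‖v k‖) ^ 2 / (εg * A.eps)) :=
      mul_nonneg (by positivity) (le_max_of_le_right
        (div_nonneg (sq_nonneg _) (mul_nonneg hεg.le A.eps_pos.le)))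
    exact_mod_cast h'.trans_lt h
  have hn' : (0 : ℝ) < n := Nat.cast_pos.2 hn0
  have hvpos : ∀ j, 0 < ‖v j‖ := fun j => norm_pos_iff.2 (hv j)
  have hεpos := A.eps_pos
  have hK : (0 : ℝ) < K := Nat.cast_pos.2 k.pos
  have hlamR : ∀ j, εg / R ≤ A.lam j * ‖v j‖ ^ 2 := by
    intro j
    have h := (hlam j).1
    have hp := hvpos j
    rw [div_le_iff₀ (by positivity)] at h ⊢
    linarith
  have hprime : A.eps / 2 ≤ A.epsPrime n := by
    -- The sum defining `ε'` runs over all groups, so the sample size condition is needed for every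
    -- `j`, not only for `k`.
    refine A.half_eps_le_epsPrime hn0 fun j => ?_
    have hp := hvpos j
    have h1 : K * R * ((A.q j * ‖v j‖) ^ 2 / (εg * A.eps)) ≤ n := by
      refine le_trans ?_ (hn j).le
      refine mul_le_mul ?_ (le_max_right _ _) (by positivity) (by positivity)
      have : 0 ≤ 32 * M / c ^ 2 + 16 * K * M / c := by positivity
      linarith
    rw [← mul_div_assoc, div_le_iff₀ (by positivity)] at h1
    have h2 := hlamR j
    rw [div_le_iff₀ hR] at h2
    have h3 : K * A.q j ^ 2 * (R * ‖v j‖ ^ 2 * εg)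
        ≤ A.eps * (n * A.lam j) * (R * ‖v j‖ ^ 2 * εg) := by
      calc K * A.q j ^ 2 * (R * ‖v j‖ ^ 2 * εg)
          = K * R * (A.q j * ‖v j‖) ^ 2 * εg := by ring
        _ ≤ n * (εg * A.eps) * (A.lam j * ‖v j‖ ^ 2 * R) :=
            mul_le_mul h1 h2 hεg.le (by positivity)
        _ = _ := by ring
    exact le_of_mul_le_mul_right h3 (by positivity)
  have hprime0 : 0 < A.epsPrime n := by linarith
  have hmin := A.isMinOn_lowModel (hg k) hprime0
  refine ⟨hmin, ?_⟩
  have := A.isProbabilityMeasure_outcomeLaw hprime0 P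
  have hXk : ∀ᵐ z ∂P, ‖(A.groupSample k z).1‖ ≤ A.q k := hX.mono fun z hz => hz k
  -- For `q k = 0` the second term of the maximum is `0` by the convention for division and gives no
  -- control of the noise, but then the loss does not depend on the model.
  rcases (A.q_nonneg k).eq_or_lt with hq | hq
  · have e : {ω | expectedLoss (A.lowModel n k ω) (A.groupLaw k P)
        ≤ expectedLoss (v k) (A.groupLaw k P) + εg} = Set.univ := by
      refine Set.eq_univ_of_forall fun ω => ?_
      have := A.expectedLoss_eq_of_q_eq_zero hq.symm hXk (A.lowModel n k ω) (v k)
      exact this.le.trans (by linarith)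
    rw [e, measure_univ]
    exact ENNReal.ofReal_le_one.2 (by linarith)
  have hvk := hvpos k
  set β : ℝ := c * εg / (2 * ‖v k‖) with hβ
  have hβv : β * ‖v k‖ = c * εg / 2 := by rw [hβ]; field_simp
  have hsum : c * εg / 2 + β * ‖v k‖ = c * εg := by rw [hβv]; ring
  have hcε : c * εg ≤ εg / R / 8 := by
    calc c * εg ≤ 1 / (8 * R) * εg := mul_le_mul_of_nonneg_right hcR hεg.le
      _ = _ := by field_simp
  have hRpos : 0 < εg / R := by positivity
  obtain ⟨B, hB, hgood⟩ := exists_event_integral_logisticLoss_le (P := P) (n := n)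
    (X := fun z => (A.groupSample k z).1) (Y := fun z => z.2) (u := u k) (v := v k)
    (l := A.lam k) (η := c * εg / 2) (β := β) (ε := εg)
    (measurable_fst.comp (A.measurable_groupSample k)) measurable_snd hXk hY hq hn0 (hv k)
    (A.lam_pos k) (by positivity) (by rw [hsum]; linarith [hlamR k])
    (by rw [hsum]; nlinarith) (hlam k).2
  refine le_measure_of_compl_subset_union (t₁ := {ω | ω.1 ∈ B}) (t₂ := {ω | n * β < ‖ω.2 k‖})
    hδ.le ?_ ?_ ?_
  · intro ω hω
    by_contra hout
    simp only [Set.mem_union, Set.mem_ofPred_eq, not_or, not_lt] at hout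
    refine hω ?_
    have hm := hmin ω
    rw [A.objective_eq (hg k) hprime0] at hm
    have h := hgood ω.1 hout.1 _ _ ?_ hm
    · simpa only [Set.mem_ofPred_eq, PSTF.expectedLoss_groupLaw] using h
    · rw [norm_smul, Real.norm_eq_abs, abs_of_pos (by positivity), one_div_mul_eq_div,
        div_le_iff₀ hn', mul_comm]
      exact hout.2
  · rw [A.outcomeLaw_samples_mem hprime0]
    refine hB.trans (ENNReal.ofReal_le_ofReal (two_mul_exp_neg_le hδ ?_))
    refine (log_four_div_le hδ hδδ₀ hδ₀).trans ?_
    have hl : 0 ≤ Real.log (1 / δ) :=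
      Real.log_nonneg ((one_le_div hδ).2 (hδδ₀.trans hδ₀.le))
    have h1 : 32 * M / c ^ 2 * ((A.q k * ‖v k‖) ^ 2 * Real.log (1 / δ) / εg ^ 2) ≤ n := by
      refine le_trans ?_ (hn k).le
      refine mul_le_mul ?_ (le_max_of_le_left (le_max_left _ _)) (by positivity) (by positivity)
      have : 0 ≤ K * R + 16 * K * M / c := by positivity
      linarith
    rw [div_mul_div_comm, div_le_iff₀ (by positivity)] at h1
    rw [le_div_iff₀ (by positivity), ← hM]
    nlinarith
  · refine (A.outcomeLaw_lt_norm_noise_le hprime0 P k _).trans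
      (ENNReal.ofReal_le_ofReal (two_pow_mul_exp_neg_le hδ ?_))
    refine (mul_log_two_add_log_le k.pos A.groups_le (A.card_group_le k) hδ hδδ₀ hδ₀).trans ?_
    rw [← hM]
    set D := (d : ℝ) * Real.log (d / (K * δ)) with hD
    have hD0 : 0 ≤ D := by
      refine mul_nonneg (Nat.cast_nonneg _) (Real.log_nonneg ?_)
      rw [one_le_div (by positivity)]
      have h1 : (K : ℝ) ≤ d := Nat.cast_le.2 A.groups_le
      have h2 : δ ≤ 1 := hδδ₀.trans hδ₀.le
      nlinarith
    have h1 : 16 * K * M / c * (D * (A.q k * ‖v k‖) / (A.q k * K * εg * A.eps)) ≤ n := by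
      refine le_trans ?_ (hn k).le
      refine mul_le_mul ?_ (le_max_of_le_left (le_max_right _ _)) (by positivity) (by positivity)
      have : 0 ≤ K * R + 32 * M / c ^ 2 := by positivity
      linarith
    have e : 16 * K * M / c * (D * (A.q k * ‖v k‖) / (A.q k * K * εg * A.eps))
        = M * D / (A.eps / 8 * β) := by
      rw [hβ]
      field_simp
      ring
    have hβ0 : 0 < β := by positivity
    rw [e, div_le_iff₀ (by positivity)] at h1
    have h2 : A.eps / 8 * (n * β) ≤ A.epsPrime n / 4 * (n * β) :=
      mul_le_mul_of_nonneg_right (by linarith) (by positivity)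
    linarith
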